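/- **Theorem 4.2.** Let $k\ge 1$, let $a_1<a_2<\cdots<a_k$ be positive integers with $\gcd(a_1,\dots,a_k)=1$, and let $r_1,\dots,r_k\ge 1$ be integers. Let $\mathbb{A}=\{a_1,\dots,a_k\}_{\vec r}$ be the finite sequence in which each $a_i$ appears exactly $r_i$ times (and which has no other terms), and let $$S(\mathbb{A})=\Big\{\sum_{b\in\mathbb{B}}b \;:\; \mathbb{B}\text{ is a nonempty subsequence of }\mathbb{A}\Big\}$$ be the set of its subsequence sums, where terms are counted with multiplicity in each sum. Let $\theta=\frac{1+\sqrt5}{2}$. Then $$|S(\mathbb{A})|\;\ge\;\begin{cases}\displaystyle\sum_{i=1}^{k} i\,r_i+a_k-k & \text{if } a_k\le 2k-3,\\[2mm] \displaystyle\sum_{i=1}^{k} i\,r_i+\theta(k+1)-k-4 & \text{if } a_k\ge 2k-2.\end{cases}$$ -/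

import Mathlib

/-- The finite sequence `{a 1, …, a k}_r` of integers in which `a i` appears `r i` times
(`1 ≤ i ≤ k`), as a multiset. -/
def seqOf (k : ℕ) (a : ℕ → ℤ) (r : ℕ → ℕ) : Multiset ℤ :=
  ∑ i ∈ Finset.Icc 1 k, Multiset.replicate (r i) (a i)

/-- The set `S(𝔸)` of the sums of all nonempty subsequences of the finite sequence `𝔸`. -/
def subsequenceSums (A : Multiset ℤ) : Finset ℤ :=
  (A.powerset.toFinset.erase 0).image Multiset.sum

theorem mem_subsequenceSums {A : Multiset ℤ} {s : ℤ} :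
    s ∈ subsequenceSums A ↔ ∃ B : Multiset ℤ, B ≠ 0 ∧ B ≤ A ∧ B.sum = s := by
  simp [subsequenceSums, and_assoc]

/-! Adjoining a term `c > 0` to `A` creates at least as many new sums as the sums of `A` have
residues mod `c`: the largest sum `m` in each class yields the new sum `c + m`
(`card_subsums_cons_ge`). Once the smaller terms are present, `0, a 1, …, a (j-1)` are distinct mod
`a j`, so each copy of `a j` gains at least `j`; this alone gives `∑ i * r i`.

The improvement comes from the first copy of `a k`, which gains the number `m` of residues mod `a k`
of subset sums of the smaller terms, hence `m - k` extra. If `a k ≤ 2k - 3`, pigeonhole makes every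
residue a sum of two distinct elements of `{0, a 1, …, a (k-1)}`, so `m = a k`. Otherwise
`subsums_eq_closure_or_two_mul_card_le`, with gcd 1 making the residues generate, gives `m ≥ 2k - 3`
for `k ≥ 2`. The resulting `∑ i * r i + k - 3` dominates the bound with the golden ratio. -/

/-- The sums of all (possibly empty) sub-multisets of `A`. -/
def subsums {M : Type*} [AddCommMonoid M] [DecidableEq M] (A : Multiset M) : Finset M :=
  (A.powerset.map Multiset.sum).toFinset

theorem mem_subsums {M : Type*} [AddCommMonoid M] [DecidableEq M] {A : Multiset M} {s : M} :
    s ∈ subsums A ↔ ∃ B ≤ A, B.sum = s := by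
  simp [subsums]

theorem zero_mem_subsums {M : Type*} [AddCommMonoid M] [DecidableEq M] (A : Multiset M) :
    (0 : M) ∈ subsums A :=
  mem_subsums.2 ⟨0, Multiset.zero_le A, Multiset.sum_zero⟩

theorem mem_subsums_of_mem {M : Type*} [AddCommMonoid M] [DecidableEq M] {A : Multiset M} {x : M}
    (hx : x ∈ A) : x ∈ subsums A :=
  mem_subsums.2 ⟨{x}, Multiset.singleton_le.2 hx, Multiset.sum_singleton x⟩

theorem subsums_cons {M : Type*} [AddCommMonoid M] [DecidableEq M] (c : M) (A : Multiset M) :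
    subsums (c ::ₘ A) = subsums A ∪ (subsums A).image (c + ·) := by
  ext s
  simp only [subsums, Multiset.powerset_cons, Multiset.map_add, Multiset.map_map,
    Multiset.toFinset_add, Finset.mem_union, Multiset.mem_toFinset, Multiset.mem_map,
    Finset.mem_image, Function.comp_apply, Multiset.sum_cons]
  aesop

theorem subsums_map {M N : Type*} [AddCommMonoid M] [DecidableEq M] [AddCommMonoid N]
    [DecidableEq N] (f : M →+ N) (A : Multiset M) :
    subsums (A.map f) = (subsums A).image f := by
  induction A using Multiset.induction_on with
  | empty => simp [subsums]
  | cons c A ih =>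
    rw [Multiset.map_cons, subsums_cons, subsums_cons, ih, Finset.image_union, Finset.image_image,
      Finset.image_image]
    congr 2
    ext x
    simp

/-! ### Translation-invariant sets and pigeonhole in abelian groups. -/

section Group

variable {G : Type*} [AddCommGroup G] [DecidableEq G]

theorem add_closure_mem_of_add_mem {B : Set G} {Z : Finset G}
    (hZ : ∀ d ∈ B, ∀ z ∈ Z, z + d ∈ Z) {g : G} (hg : g ∈ AddSubgroup.closure B) :
    ∀ z ∈ Z, z + g ∈ Z := by
  induction hg using AddSubgroup.closure_induction with
  | mem d hd => exact hZ d hd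
  | zero => simp
  | add x y _ _ hx hy => intro z hz; rw [← add_assoc]; exact hy _ (hx z hz)
  | neg x _ hx =>
    intro z hz
    -- An injective translation of a finite set into itself is onto, so it can be undone.
    have himg : Z.image (· + x) = Z := by
      apply Finset.eq_of_subset_of_card_le
      · intro y hy
        obtain ⟨w, hw, rfl⟩ := Finset.mem_image.1 hy
        exact hx w hw
      · rw [Finset.card_image_of_injective _ (add_left_injective x)]
    rw [← himg] at hz
    obtain ⟨w, hw, rfl⟩ := Finset.mem_image.1 hz
    simpa using hw

theorem subsums_subset_closure (B : Finset G) :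
    ∀ x ∈ subsums B.val, x ∈ AddSubgroup.closure (B : Set G) := by
  intro x hx
  obtain ⟨C, hC, rfl⟩ := mem_subsums.1 hx
  exact AddSubgroup.multiset_sum_mem _ _ fun y hy =>
    AddSubgroup.subset_closure (Multiset.mem_of_le hC hy)

/-- `C` and `q - C` both lie in `Y`, so they share at least three elements, and at most two of these
satisfy `y + y = q`. -/
theorem exists_ne_add_eq (h2 : ∀ x : G, ∀ s : Finset G, (∀ y ∈ s, y + y = x) → s.card ≤ 2)
    {C Y : Finset G} {q : G} (hC : C ⊆ Y) (hqC : ∀ y ∈ C, q - y ∈ Y)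
    (hcard : Y.card + 3 ≤ 2 * C.card) : ∃ y ∈ C, ∃ z ∈ C, y ≠ z ∧ y + z = q := by
  by_contra! hne
  have h1 : (C ∩ C.image (q - ·)).card ≤ 2 := by
    apply h2 q
    intro y hy
    rw [Finset.mem_inter, Finset.mem_image] at hy
    obtain ⟨hy, w, hw, rfl⟩ := hy
    by_contra hcon
    refine hne _ hy w hw ?_ (by abel)
    rintro h
    apply hcon
    nth_rewrite 2 [h]
    abel
  have h3 := Finset.card_union_add_card_inter C (C.image (q - ·))
  rw [Finset.card_image_of_injective _ (sub_right_injective)] at h3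
  have h4 : (C ∪ C.image (q - ·)).card ≤ Y.card := by
    apply Finset.card_le_card
    apply Finset.union_subset hC
    intro y hy
    obtain ⟨w, hw, rfl⟩ := Finset.mem_image.1 hy
    exact hqC w hw
  omega

theorem add_mem_subsums {B : Finset G} {y z : G} (hy : y ∈ insert 0 B) (hz : z ∈ insert 0 B)
    (hne : y ≠ z) : y + z ∈ subsums B.val := by
  rw [Finset.mem_insert] at hy hz
  rcases hy with rfl | hy
  · rcases hz with rfl | hz
    · exact absurd rfl hne
    · simpa using mem_subsums_of_mem (A := B.val) hz
  · rcases hz with rfl | hz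
    · simpa using mem_subsums_of_mem (A := B.val) hy
    · refine mem_subsums.2 ⟨({y, z} : Finset G).val, ?_, ?_⟩
      · rw [Finset.val_le_iff]
        intro w hw
        rw [Finset.mem_insert, Finset.mem_singleton] at hw
        rcases hw with rfl | rfl <;> assumption
      · have h := Finset.sum_pair (f := fun x : G => x) hne
        simpa [Finset.sum] using h

theorem card_add_one_le_card_subsums {B : Finset G} (h0 : (0 : G) ∉ B) :
    B.card + 1 ≤ (subsums B.val).card := by
  rw [← Finset.card_insert_of_notMem h0]
  apply Finset.card_le_card
  intro x hx
  rcases Finset.mem_insert.1 hx with rfl | hx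
  · exact zero_mem_subsums _
  · exact mem_subsums_of_mem hx

/-! ### Sets that almost equal their translates. -/

/-- Translating `X` by `b` removes the single element `p` and adds the single element `q`. -/
structure ShiftsOne (X : Finset G) (b p q : G) : Prop where
  mem : p ∈ X
  notMem : q ∉ X
  iff : ∀ x, x - b ∈ X ↔ (x ∈ X ∧ x ≠ p) ∨ x = q

theorem ShiftsOne.neg {X : Finset G} {b p q p' q' : G} (h : ShiftsOne X b p q)
    (h' : ShiftsOne X (-b) p' q') : p' = q - b ∧ q' = p - b := by
  have e1 : q - b ∈ X := (h.iff q).2 (Or.inr rfl)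
  have e2 : p - b ∉ X := fun hc => by
    rcases (h.iff p).1 hc with h1 | h1
    · exact h1.2 rfl
    · exact h.notMem (h1 ▸ h.mem)
  have e3 := h'.iff (q - b)
  have e4 := h'.iff (p - b)
  simp only [sub_neg_eq_add, sub_add_cancel] at e3 e4
  constructor
  · by_contra hne
    exact h.notMem (e3.2 (Or.inl ⟨e1, Ne.symm hne⟩))
  · rcases e4.1 h.mem with h1 | h1
    · exact absurd h1.1 e2
    · exact h1.symm

/-- Translations commute: `key` compares the two descriptions of `X + b + c`. -/
theorem ShiftsOne.cases {X : Finset G} {b c p q p' q' : G} (h : ShiftsOne X b p q)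
    (h' : ShiftsOne X c p' q') (hb : b ≠ 0) (hc : c ≠ 0) (hbc : b ≠ c) (hbc' : b + c ≠ 0) :
    (p = p' ∧ q = p + b ∧ q' = p + c) ∨ (q = q' ∧ p = q + b ∧ p' = q + c) := by
  have key : ∀ x, ((((x ∈ X ∧ x ≠ p') ∨ x = q') ∧ x ≠ p + c) ∨ x = q + c) ↔
      ((((x ∈ X ∧ x ≠ p) ∨ x = q) ∧ x ≠ p' + b) ∨ x = q' + b) := by
    intro x
    have e1 := h.iff (x - c)
    have e2 := h'.iff (x - b)
    simp only [h'.iff x, sub_eq_iff_eq_add, ne_eq] at e1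
    simp only [h.iff x, sub_eq_iff_eq_add, ne_eq] at e2
    rw [sub_right_comm] at e2
    exact e1.symm.trans e2
  have hp := h.mem
  have hp' := h'.mem
  have hq := h.notMem
  have hq' := h'.notMem
  have n1 : ∀ x : G, x ≠ x + b := fun x => by simpa using hb
  have n2 : ∀ x : G, x ≠ x + c := fun x => by simpa using hc
  have cq' : q ≠ q' → q' = p + c := by
    intro hne
    by_contra hn
    rcases (key q').1 (Or.inl ⟨Or.inr rfl, hn⟩) with ⟨⟨hx, _⟩ | hx, _⟩ | hx
    · exact hq' hx
    · exact hne hx.symm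
    · exact n1 _ hx
  have cq : q ≠ q' → q = p' + b := by
    intro hne
    by_contra hn
    rcases (key q).2 (Or.inl ⟨Or.inr rfl, hn⟩) with ⟨⟨hx, _⟩ | hx, _⟩ | hx
    · exact hq hx
    · exact hne hx
    · exact n2 _ hx
  have cp : p ≠ p' → p = q' + b := by
    intro hne
    rcases (key p).1 (Or.inl ⟨Or.inl ⟨hp, hne⟩, n2 p⟩) with ⟨⟨_, hx⟩ | hx, _⟩ | hx
    · exact absurd rfl hx
    · exact absurd (hx ▸ hp) hq
    · exact hx
  have cp' : p ≠ p' → p' = q + c := by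
    intro hne
    rcases (key p').2 (Or.inl ⟨Or.inl ⟨hp', hne.symm⟩, n1 p'⟩) with ⟨⟨_, hx⟩ | hx, _⟩ | hx
    · exact absurd rfl hx
    · exact absurd (hx ▸ hp') hq'
    · exact hx
  by_cases hpp : p = p'
  · subst hpp
    by_cases hqq : q = q'
    · exfalso
      subst hqq
      have n3 : p + b ≠ p + c := by simpa using hbc
      have hX : ((p + b ∈ X ∧ p + b ≠ p) ∨ p + b = q) :=
        (h.iff (p + b)).1 (by rwa [add_sub_cancel_right])
      rcases (key (p + b)).1 (Or.inl ⟨hX, n3⟩) with hx | hx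
      · exact hx.2 rfl
      · exact hq (add_right_cancel hx ▸ hp)
    · exact Or.inl ⟨rfl, cq hqq, cq' hqq⟩
  · right
    by_cases hqq : q = q'
    · exact ⟨hqq, hqq ▸ cp hpp, cp' hpp⟩
    · exfalso
      have a3 := cq' hqq
      rw [cp hpp, add_assoc, left_eq_add] at a3
      exact hbc' a3

/-- A pair `b`, `c` with `c ≠ ±b` fixes which alternative of `ShiftsOne.cases` holds. An element `d`
following the other alternative with `b` is refuted by comparing it with `c`. -/
theorem ShiftsOne.uniform {X B : Finset G} (h0 : (0 : G) ∉ B) (hB : 3 ≤ B.card)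
    (p q : G → G) (h : ∀ b ∈ B, ShiftsOne X b (p b) (q b)) :
    (∃ p₀, ∀ d ∈ B, p d = p₀ ∧ q d = p₀ + d) ∨ (∃ q₀, ∀ d ∈ B, q d = q₀ ∧ p d = q₀ + d) := by
  have hne : ∀ b ∈ B, b ≠ 0 := fun b hb e => h0 (e ▸ hb)
  obtain ⟨b, hb⟩ : B.Nonempty := Finset.card_pos.1 (by omega)
  obtain ⟨c, hc, hcb⟩ : ∃ c ∈ B, c ∉ ({b, -b} : Finset G) := by
    apply Finset.exists_mem_notMem_of_card_lt_card
    exact lt_of_le_of_lt Finset.card_le_two hB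
  simp only [Finset.mem_insert, Finset.mem_singleton, not_or] at hcb
  have hbc' : b + c ≠ 0 := fun e => hcb.2 (eq_neg_of_add_eq_zero_right e)
  have hmain := (h b hb).cases (h c hc) (hne b hb) (hne c hc) (Ne.symm hcb.1) hbc'
  have hd : ∀ e ∈ B, ∀ d ∈ B, d = e ∨ (p d = q e - e ∧ q d = p e - e ∧ d = -e) ∨
      e + d ≠ 0 ∧ ((p e = p d ∧ q e = p e + e ∧ q d = p e + d) ∨
        (q e = q d ∧ p e = q e + e ∧ p d = q e + d)) := by
    intro e he d hd
    by_cases h1 : d = e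
    · exact Or.inl h1
    by_cases h2 : e + d = 0
    · obtain rfl : d = -e := eq_neg_of_add_eq_zero_right h2
      have h4 := (h e he).neg (h _ hd)
      exact Or.inr (Or.inl ⟨h4.1, h4.2, rfl⟩)
    · exact Or.inr (Or.inr
        ⟨h2, (h e he).cases (h d hd) (hne e he) (hne d hd) (Ne.symm h1) h2⟩)
  rcases hmain with ⟨m1, m2, m3⟩ | ⟨m1, m2, m3⟩
  · left
    refine ⟨p b, fun d hdB => ?_⟩
    rcases hd b hb d hdB with rfl | ⟨d1, d2, rfl⟩ | ⟨hbd, ⟨d1, -, d3⟩ | ⟨d1, -, d3⟩⟩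
    · exact ⟨rfl, m2⟩
    · exact ⟨by rw [d1, m2, add_sub_cancel_right], by rw [d2, sub_eq_add_neg]⟩
    · exact ⟨d1.symm, d3⟩
    · exfalso
      rw [m2, add_assoc] at d3
      rcases hd c hc d hdB with rfl | ⟨e1, -, -⟩ | ⟨-, ⟨e1, -, -⟩ | ⟨e1, -, -⟩⟩
      · rw [← m1, left_eq_add] at d3
        exact hbd d3
      · rw [m3, add_sub_cancel_right] at e1
        rw [e1, left_eq_add] at d3
        exact hbd d3
      · rw [← e1, ← m1, left_eq_add] at d3
        exact hbd d3
      · rw [← d1, m3, m2, add_right_inj] at e1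
        exact hcb.1 e1
  · right
    refine ⟨q b, fun d hdB => ?_⟩
    rcases hd b hb d hdB with rfl | ⟨d1, d2, rfl⟩ | ⟨hbd, ⟨d1, -, d3⟩ | ⟨d1, -, d3⟩⟩
    · exact ⟨rfl, m2⟩
    · exact ⟨by rw [d2, m2, add_sub_cancel_right], by rw [d1, sub_eq_add_neg]⟩
    · exfalso
      rw [m2, add_assoc] at d3
      rcases hd c hc d hdB with rfl | ⟨-, e1, -⟩ | ⟨-, ⟨e1, -, -⟩ | ⟨e1, -, -⟩⟩
      · rw [← m1, left_eq_add] at d3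
        exact hbd d3
      · rw [m3, add_sub_cancel_right] at e1
        rw [e1, left_eq_add] at d3
        exact hbd d3
      · rw [← d1, m3, m2, add_right_inj] at e1
        exact hcb.1 e1
      · rw [← e1, ← m1, left_eq_add] at d3
        exact hbd d3
    · exact ⟨d1.symm, d3⟩

theorem exists_shiftsOne {X : Finset G} {b : G} (hle : (X.image (· + b) \ X).card ≤ 1)
    (hne : (X.image (· + b) \ X).Nonempty) : ∃ p q, ShiftsOne X b p q := by
  have h1 : (X.image (· + b) \ X).card = 1 := le_antisymm hle (Finset.card_pos.2 hne)
  have h2 : (X \ X.image (· + b)).card = 1 := by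
    rw [← h1]
    exact (Finset.card_sdiff_comm (Finset.card_image_of_injective _ (add_left_injective b))).symm
  obtain ⟨q, hq⟩ := Finset.card_eq_one.1 h1
  obtain ⟨p, hp⟩ := Finset.card_eq_one.1 h2
  have hmem : ∀ x, x ∈ X.image (· + b) ↔ x - b ∈ X := by
    intro x
    simp [sub_eq_add_neg]
  have hp' : ∀ x, (x ∈ X ∧ x - b ∉ X) ↔ x = p := by
    intro x
    rw [← hmem, ← Finset.mem_sdiff, hp, Finset.mem_singleton]
  have hq' : ∀ x, (x - b ∈ X ∧ x ∉ X) ↔ x = q := by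
    intro x
    rw [← hmem, ← Finset.mem_sdiff, hq, Finset.mem_singleton]
  refine ⟨p, q, ((hp' p).2 rfl).1, ((hq' q).2 rfl).2, fun x => ?_⟩
  have := hp' x
  have := hq' x
  tauto

/-- In a minimal counterexample, the set `X` of sums differs from each translate `X + b` by exactly
one element. By `ShiftsOne.uniform`, deleting one point from `X` or adding one then gives a set
invariant under all of `B`; both are impossible. -/
theorem subsums_eq_closure_or_two_mul_card_le
    (h2 : ∀ x : G, ∀ s : Finset G, (∀ y ∈ s, y + y = x) → s.card ≤ 2) (B : Finset G)
    (h0 : (0 : G) ∉ B) :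
    (∀ x, x ∈ subsums B.val ↔ x ∈ AddSubgroup.closure (B : Set G)) ∨
      2 * B.card ≤ (subsums B.val).card + 1 := by
  induction hm : B.card using Nat.strong_induction_on generalizing B with
  | _ m ih =>
  subst hm
  by_contra! hcon
  obtain ⟨hcl, hlt⟩ := hcon
  have hncl : ¬ ∀ g ∈ AddSubgroup.closure (B : Set G), g ∈ subsums B.val := fun hc => by
    obtain ⟨x, hx⟩ := hcl
    have := hc x
    have := subsums_subset_closure B x
    tauto
  have hX1 := card_add_one_le_card_subsums h0
  have hcons : ∀ b ∈ B, subsums B.val =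
      subsums (B.erase b).val ∪ (subsums (B.erase b).val).image (b + ·) := by
    intro b hb
    rw [← subsums_cons, Finset.erase_val, Multiset.cons_erase hb]
  -- Let `T` be the sums without `b`. If `T` is a subgroup, then `X` is the full closure or has
  -- `2|T| ≥ 2|B|` elements. Otherwise `|T| ≥ 2|B| - 3`, so `|X \ T| ≤ 1`, and only `x ∈ X \ T` can
  -- have `x + b ∉ X`.
  have hstep : ∀ b ∈ B, ((subsums B.val).image (· + b) \ subsums B.val).card ≤ 1 := by
    intro b hb
    have he := Finset.card_erase_add_one hb
    have h0' : (0 : G) ∉ B.erase b := fun hc => h0 (Finset.mem_of_mem_erase hc)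
    have hT1 := card_add_one_le_card_subsums h0'
    rcases ih _ (by omega) (B.erase b) h0' rfl with h | h
    · exfalso
      by_cases hbm : b ∈ AddSubgroup.closure ((B.erase b : Finset G) : Set G)
      · apply hncl
        intro g hg
        rw [hcons b hb, Finset.mem_union]
        left
        rw [h]
        refine (AddSubgroup.closure_le _).2 ?_ hg
        intro x hx
        by_cases hxb : x = b
        · rw [hxb]; exact hbm
        · exact AddSubgroup.subset_closure (Finset.mem_erase.2 ⟨hxb, hx⟩)
      · have hdisj : Disjoint (subsums (B.erase b).val)
            ((subsums (B.erase b).val).image (b + ·)) := by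
          rw [Finset.disjoint_left]
          intro x hx hx'
          obtain ⟨y, hy, rfl⟩ := Finset.mem_image.1 hx'
          rw [h] at hx hy
          exact hbm ((AddSubgroup.add_mem_cancel_right _ hy).1 hx)
        have hcard := congrArg Finset.card (hcons b hb)
        rw [Finset.card_union_of_disjoint hdisj,
          Finset.card_image_of_injective _ (add_right_injective b)] at hcard
        omega
    · have hsub : subsums (B.erase b).val ⊆ subsums B.val := by
        rw [hcons b hb]; exact Finset.subset_union_left
      have hd : (subsums B.val \ subsums (B.erase b).val).card ≤ 1 := by
        rw [Finset.card_sdiff_of_subset hsub]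
        omega
      refine le_trans (Finset.card_le_card_of_injOn (· - b) ?_ (sub_left_injective.injOn)) hd
      intro y hy
      rw [Finset.mem_coe, Finset.mem_sdiff, Finset.mem_image] at hy
      obtain ⟨⟨x, hx, rfl⟩, hy⟩ := hy
      rw [Finset.mem_coe, Finset.mem_sdiff]
      simp only [add_sub_cancel_right]
      refine ⟨hx, fun hx' => hy ?_⟩
      rw [hcons b hb, Finset.mem_union, Finset.mem_image]
      exact Or.inr ⟨x, hx', add_comm _ _⟩
  set X := subsums B.val with hX
  -- If `X + b = X`, each `(X + d) \ X` is invariant under `b ≠ 0` and has at most one element, so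
  -- it is empty; then `X` is the full closure.
  have hstable : ∀ b ∈ B, (X.image (· + b) \ X).Nonempty := by
    intro b hb
    by_contra hemp
    rw [Finset.not_nonempty_iff_eq_empty, Finset.sdiff_eq_empty_iff_subset] at hemp
    have hbX : ∀ d ∈ ({b} : Set G), ∀ x ∈ X, x + d ∈ X := by
      rintro d rfl x hx
      exact hemp (Finset.mem_image_of_mem _ hx)
    have hbX' : ∀ x ∈ X, x - b ∈ X := by
      intro x hx
      rw [sub_eq_add_neg]
      exact add_closure_mem_of_add_mem hbX
        (neg_mem (AddSubgroup.subset_closure (Set.mem_singleton b))) x hx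
    apply hncl
    intro g hg
    have hall : ∀ d ∈ (B : Set G), ∀ x ∈ X, x + d ∈ X := by
      intro d hd x hx
      by_contra hxd
      have hm1 : x + d ∈ X.image (· + d) \ X :=
        Finset.mem_sdiff.2 ⟨Finset.mem_image_of_mem _ hx, hxd⟩
      have hm2 : x + b + d ∈ X.image (· + d) \ X := by
        refine Finset.mem_sdiff.2 ⟨Finset.mem_image_of_mem _ (hbX b rfl x hx), fun hc => hxd ?_⟩
        have := hbX' _ hc
        rwa [add_right_comm, add_sub_cancel_right] at this
      have := Finset.card_le_one.1 (hstep d hd) _ hm1 _ hm2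
      rw [add_left_inj, left_eq_add] at this
      exact h0 (this ▸ hb)
    simpa using add_closure_mem_of_add_mem hall hg 0 (zero_mem_subsums _)
  have hex : ∀ b, ∃ p q, b ∈ B → ShiftsOne X b p q := by
    intro b
    by_cases hb : b ∈ B
    · obtain ⟨p, q, h⟩ := exists_shiftsOne (hstep b hb) (hstable b hb)
      exact ⟨p, q, fun _ => h⟩
    · exact ⟨0, 0, fun h => absurd h hb⟩
  choose p q hpq using hex
  obtain ⟨b, hb⟩ : B.Nonempty := Finset.card_pos.1 (by omega)
  rcases ShiftsOne.uniform h0 (by omega) p q hpq with ⟨p₀, hp⟩ | ⟨q₀, hq⟩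
  -- `X` minus `p₀` is nonempty and invariant under the closure, so it would contain `p₀`.
  · have hp₀ : p₀ ∈ X := (hp b hb).1 ▸ (hpq b hb).mem
    obtain ⟨z, hz⟩ : (X.erase p₀).Nonempty := by
      apply Finset.card_pos.1
      rw [Finset.card_erase_of_mem hp₀]
      omega
    have hcl' := add_closure_mem_of_add_mem (B := (B : Set G)) (Z := X.erase p₀) ?_
      (sub_mem (subsums_subset_closure B p₀ hp₀)
        (subsums_subset_closure B z (Finset.mem_of_mem_erase hz))) z hz
    · rw [add_sub_cancel] at hcl'
      exact Finset.notMem_erase _ _ hcl'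
    · intro d hd x hx
      obtain ⟨hx1, hx2⟩ := Finset.mem_erase.1 hx
      have h3 := ((hpq d hd).iff (x + d)).1 (by rwa [add_sub_cancel_right])
      rw [(hp d hd).1, (hp d hd).2, add_left_inj] at h3
      rcases h3 with h3 | h3
      · exact Finset.mem_erase.2 ⟨h3.2, h3.1⟩
      · exact absurd h3 hx1
  -- The closure is contained in `X` plus `q₀`, small enough for pigeonhole to write `q₀` as a sum
  -- of two distinct elements of `{0} ∪ B`.
  · have hqX : q₀ ∉ X := (hq b hb).1 ▸ (hpq b hb).notMem
    have hY : ∀ g ∈ AddSubgroup.closure (B : Set G), g ∈ insert q₀ X := by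
      intro g hg
      have := add_closure_mem_of_add_mem (B := (B : Set G)) (Z := insert q₀ X) ?_ hg 0
        (Finset.mem_insert_of_mem (zero_mem_subsums _))
      · simpa using this
      · intro d hd x hx
        rcases Finset.mem_insert.1 hx with rfl | hx
        · rw [← (hq d hd).2]
          exact Finset.mem_insert_of_mem (hpq d hd).mem
        · have h3 := ((hpq d hd).iff (x + d)).1 (by rwa [add_sub_cancel_right])
          rw [(hq d hd).1] at h3
          rcases h3 with h3 | h3
          · exact Finset.mem_insert_of_mem h3.1
          · rw [h3]; exact Finset.mem_insert_self _ _
    have hqcl : q₀ ∈ AddSubgroup.closure (B : Set G) := by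
      have h4 := subsums_subset_closure B _ (hpq b hb).mem
      rw [(hq b hb).2] at h4
      exact (AddSubgroup.add_mem_cancel_right _ (AddSubgroup.subset_closure hb)).1 h4
    have hB0 : ∀ y ∈ insert 0 B, y ∈ AddSubgroup.closure (B : Set G) := by
      intro y hy
      rcases Finset.mem_insert.1 hy with rfl | hy
      · exact zero_mem _
      · exact AddSubgroup.subset_closure hy
    obtain ⟨y, hy, z, hz, hyz, hsum⟩ := exists_ne_add_eq h2 (C := insert 0 B)
      (Y := insert q₀ X) (q := q₀) (fun y hy => hY y (hB0 y hy))
      (fun y hy => hY _ (sub_mem hqcl (hB0 y hy))) (by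
        rw [Finset.card_insert_of_notMem h0, Finset.card_insert_of_notMem hqX]
        omega)
    exact hqX (hsum ▸ add_mem_subsums hy hz hyz)

end Group

/-! ### Residues, and the gain from one new integer term. -/

theorem card_le_two_of_add_self_eq {l : ℕ} [NeZero l] (x : ZMod l) (s : Finset (ZMod l))
    (hs : ∀ y ∈ s, y + y = x) : s.card ≤ 2 := by
  rcases s.eq_empty_or_nonempty with rfl | ⟨y₀, hy₀⟩
  · simp
  · have h := IsAddCyclic.card_nsmul_eq_zero_le (α := ZMod l) (n := 2) (by norm_num)
    refine le_trans (Finset.card_le_card_of_injOn (· - y₀) ?_ sub_left_injective.injOn) h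
    intro y hy
    simp only [Finset.coe_filter, Finset.mem_univ, true_and, Set.mem_ofPred_eq]
    rw [two_nsmul, sub_add_sub_comm, hs y hy, hs y₀ hy₀, sub_self]

theorem card_subsums_le (A : Multiset ℤ) :
    (subsums A).card ≤ (subsequenceSums A).card + 1 := by
  refine le_trans (Finset.card_le_card ?_) (Finset.card_insert_le 0 _)
  intro x hx
  obtain ⟨B, hB, rfl⟩ := mem_subsums.1 hx
  by_cases h : B = 0
  · simp [h]
  · exact Finset.mem_insert_of_mem (mem_subsequenceSums.2 ⟨B, h, hB, rfl⟩)

theorem card_image_cast_le (T : Finset ℤ) {c : ℕ} (hc : 0 < c) :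
    (T.image (Int.cast : ℤ → ZMod c)).card ≤ (T.image ((c : ℤ) + ·) \ T).card := by
  refine le_trans (Finset.card_le_card ?_)
    (Finset.card_image_le (f := (Int.cast : ℤ → ZMod c)))
  intro x hx
  obtain ⟨t, ht, rfl⟩ := Finset.mem_image.1 hx
  obtain ⟨m, hm, hmax⟩ := Finset.exists_max_image
    (T.filter fun s : ℤ => (s : ZMod c) = (t : ZMod c)) id ⟨t, by simp [ht]⟩
  obtain ⟨hmT, hmt⟩ := Finset.mem_filter.1 hm
  have hcast : (((c : ℤ) + m : ℤ) : ZMod c) = (t : ZMod c) := by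
    push_cast
    simp [hmt]
  refine Finset.mem_image.2 ⟨(c : ℤ) + m, ?_, hcast⟩
  refine Finset.mem_sdiff.2 ⟨Finset.mem_image_of_mem _ hmT, fun hin => ?_⟩
  have := hmax _ (Finset.mem_filter.2 ⟨hin, hcast⟩)
  simp only [id] at this
  omega

theorem card_subsums_cons_ge (A : Multiset ℤ) {c : ℕ} (hc : 0 < c) :
    (subsums A).card + (subsums (A.map (Int.cast : ℤ → ZMod c))).card
      ≤ (subsums ((c : ℤ) ::ₘ A)).card := by
  have h := card_image_cast_le (subsums A) hc
  have h' := subsums_map (Int.castAddHom (ZMod c)) A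
  rw [Int.coe_castAddHom] at h'
  rw [h', subsums_cons, ← Finset.union_sdiff_self_eq_union,
    Finset.card_union_of_disjoint Finset.disjoint_sdiff]
  exact Nat.add_le_add_left h _

theorem cast_injOn_Ico (c : ℕ) : Set.InjOn (Int.cast : ℤ → ZMod c) (Set.Ico 0 (c : ℤ)) := by
  intro x hx y hy hxy
  rw [ZMod.intCast_eq_intCast_iff'] at hxy
  rwa [Int.emod_eq_of_lt hx.1 hx.2, Int.emod_eq_of_lt hy.1 hy.2] at hxy

theorem card_subsums_add_card_le (A : Multiset ℤ) {c : ℤ} (hc : 0 < c) (C : Finset ℤ)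
    (hCA : C ⊆ subsums A) (hC : ∀ x ∈ C, 0 ≤ x ∧ x < c) :
    (subsums A).card + C.card ≤ (subsums (c ::ₘ A)).card := by
  lift c to ℕ using hc.le
  refine le_trans ?_ (card_subsums_cons_ge A (by omega))
  have h' := subsums_map (Int.castAddHom (ZMod c)) A
  rw [Int.coe_castAddHom] at h'
  rw [h', ← Finset.card_image_of_injOn (s := C) ((cast_injOn_Ico c).mono hC)]
  exact Nat.add_le_add_left (Finset.card_le_card (Finset.image_subset_image hCA)) _

/-! ### Building the sequence term by term. -/

section Increasing

variable {k : ℕ} {a : ℕ → ℤ}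

theorem card_insert_zero_image (hpos : ∀ i ∈ Finset.Icc 1 k, 0 < a i)
    (hmono : StrictMonoOn a (Set.Icc 1 k)) {j : ℕ} (hj : j ∈ Finset.Icc 1 k) :
    (insert 0 ((Finset.Ico 1 j).image a)).card = j := by
  rw [Finset.mem_Icc] at hj
  have hsub : ∀ i ∈ Finset.Ico 1 j, i ∈ Finset.Icc 1 k := fun i hi => by
    rw [Finset.mem_Ico] at hi
    rw [Finset.mem_Icc]
    omega
  rw [Finset.card_insert_of_notMem, Finset.card_image_of_injOn, Nat.card_Ico]
  · omega
  · exact hmono.injOn.mono fun i hi => by simpa using hsub i hi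
  · intro h0
    obtain ⟨i, hi, h⟩ := Finset.mem_image.1 h0
    have := hpos i (hsub i hi)
    omega

theorem insert_zero_image_bounds (hpos : ∀ i ∈ Finset.Icc 1 k, 0 < a i)
    (hmono : StrictMonoOn a (Set.Icc 1 k)) {j : ℕ} (hj : j ∈ Finset.Icc 1 k) :
    ∀ x ∈ insert 0 ((Finset.Ico 1 j).image a), 0 ≤ x ∧ x < a j := by
  intro x hx
  rcases Finset.mem_insert.1 hx with rfl | hx
  · exact ⟨le_rfl, hpos j hj⟩
  · obtain ⟨i, hi, rfl⟩ := Finset.mem_image.1 hx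
    rw [Finset.mem_Ico] at hi
    rw [Finset.mem_Icc] at hj
    refine ⟨(hpos i (Finset.mem_Icc.2 (by omega))).le, hmono ?_ ?_ hi.2⟩
    · exact Set.mem_Icc.2 (by omega)
    · exact Set.mem_Icc.2 hj

theorem card_subsums_add_index_le (hpos : ∀ i ∈ Finset.Icc 1 k, 0 < a i)
    (hmono : StrictMonoOn a (Set.Icc 1 k)) {j : ℕ} (hj : j ∈ Finset.Icc 1 k) (A : Multiset ℤ)
    (hA : ∀ i ∈ Finset.Ico 1 j, a i ∈ A) :
    (subsums A).card + j ≤ (subsums (a j ::ₘ A)).card := by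
  have h := card_subsums_add_card_le A (hpos j hj) (insert 0 ((Finset.Ico 1 j).image a)) ?_
    (insert_zero_image_bounds hpos hmono hj)
  · rwa [card_insert_zero_image hpos hmono hj] at h
  · intro x hx
    rcases Finset.mem_insert.1 hx with rfl | hx
    · exact zero_mem_subsums A
    · obtain ⟨i, hi, rfl⟩ := Finset.mem_image.1 hx
      exact mem_subsums_of_mem (hA i hi)

theorem card_subsums_add_replicate (hpos : ∀ i ∈ Finset.Icc 1 k, 0 < a i)
    (hmono : StrictMonoOn a (Set.Icc 1 k)) {j : ℕ} (hj : j ∈ Finset.Icc 1 k) (A : Multiset ℤ)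
    (hA : ∀ i ∈ Finset.Ico 1 j, a i ∈ A) (n : ℕ) :
    (subsums A).card + j * n ≤ (subsums (A + Multiset.replicate n (a j))).card := by
  induction n with
  | zero => simp
  | succ n ih =>
    rw [Multiset.replicate_succ, Multiset.add_cons]
    have := card_subsums_add_index_le hpos hmono hj (A + Multiset.replicate n (a j))
      fun i hi => Multiset.mem_add.2 (Or.inl (hA i hi))
    rw [Nat.mul_succ]
    omega

theorem card_subsums_add_sum_replicate (hpos : ∀ i ∈ Finset.Icc 1 k, 0 < a i)
    (hmono : StrictMonoOn a (Set.Icc 1 k)) (A : Multiset ℤ)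
    (hA : ∀ i ∈ Finset.Icc 1 k, a i ∈ A) (n : ℕ → ℕ) (s : Finset ℕ) (hs : s ⊆ Finset.Icc 1 k) :
    (subsums A).card + ∑ i ∈ s, i * n i
      ≤ (subsums (A + ∑ i ∈ s, Multiset.replicate (n i) (a i))).card := by
  induction s using Finset.induction_on with
  | empty => simp
  | insert j s hjs ih =>
    have hj : j ∈ Finset.Icc 1 k := hs (Finset.mem_insert_self j s)
    have h1 := ih fun i hi => hs (Finset.mem_insert_of_mem hi)
    have h2 := card_subsums_add_replicate hpos hmono hj
      (A + ∑ i ∈ s, Multiset.replicate (n i) (a i)) (fun i hi => by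
        refine Multiset.mem_add.2 (Or.inl (hA i ?_))
        rw [Finset.mem_Icc] at hj ⊢
        rw [Finset.mem_Ico] at hi
        omega) (n j)
    rw [Finset.sum_insert hjs, Finset.sum_insert hjs, add_comm (Multiset.replicate _ _),
      ← add_assoc A]
    omega

theorem sum_index_le_card_subsums (hpos : ∀ i ∈ Finset.Icc 1 k, 0 < a i)
    (hmono : StrictMonoOn a (Set.Icc 1 k)) (j : ℕ) (hj : j ≤ k) :
    1 + ∑ i ∈ Finset.Icc 1 j, i ≤ (subsums ((Finset.Icc 1 j).val.map a)).card := by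
  induction j with
  | zero => simp [subsums]
  | succ j ih =>
    have hI : Finset.Icc 1 (j + 1) = Finset.cons (j + 1) (Finset.Icc 1 j) (by simp) := by
      ext i
      simp only [Finset.mem_cons, Finset.mem_Icc]
      omega
    have h := card_subsums_add_index_le hpos hmono (j := j + 1)
      (Finset.mem_Icc.2 ⟨by omega, hj⟩) ((Finset.Icc 1 j).val.map a)
      (fun i hi => by
        refine Multiset.mem_map_of_mem a ?_
        rw [Finset.mem_val, Finset.mem_Icc]
        rw [Finset.mem_Ico] at hi
        omega)
    have := ih (by omega)
    rw [hI, Finset.sum_cons, Finset.cons_val, Multiset.map_cons]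
    omega

/-- A gain of `e` over the trivial `k` new sums when `a k` joins the set of smaller terms is a
gain of `e` in the total number of sums. -/
theorem sum_mul_add_le_card_subsequenceSums (hk : 1 ≤ k) {r : ℕ → ℕ}
    (hpos : ∀ i ∈ Finset.Icc 1 k, 0 < a i) (hmono : StrictMonoOn a (Set.Icc 1 k))
    (hr : ∀ i ∈ Finset.Icc 1 k, 1 ≤ r i) {l m : ℕ} (hl : a k = l)
    (hm : m ≤ (subsums (((Finset.Ico 1 k).val.map a).map (Int.cast : ℤ → ZMod l))).card) :
    ∑ i ∈ Finset.Icc 1 k, i * r i + m ≤ (subsequenceSums (seqOf k a r)).card + k := by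
  have hkI : k ∈ Finset.Icc 1 k := Finset.mem_Icc.2 ⟨hk, le_rfl⟩
  have hlpos : 0 < l := by
    have := hpos k hkI
    omega
  have hIco : Finset.Ico 1 k = Finset.Icc 1 (k - 1) := by
    ext i
    simp only [Finset.mem_Ico, Finset.mem_Icc]
    omega
  have hI : Finset.Icc 1 k = Finset.cons k (Finset.Ico 1 k) (by simp) := by
    ext i
    simp only [Finset.mem_cons, Finset.mem_Icc, Finset.mem_Ico]
    omega
  have h1 := sum_index_le_card_subsums hpos hmono (k - 1) (by omega)
  have h2 := card_subsums_cons_ge ((Finset.Ico 1 k).val.map a) hlpos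
  -- One copy of every term is already present, so the remaining `r i - 1` copies may come in any
  -- order.
  have h3 := card_subsums_add_sum_replicate hpos hmono ((Finset.Icc 1 k).val.map a)
    (fun i hi => Multiset.mem_map_of_mem a hi) (fun i => r i - 1) (Finset.Icc 1 k) subset_rfl
  have hseq : (Finset.Icc 1 k).val.map a + ∑ i ∈ Finset.Icc 1 k, Multiset.replicate (r i - 1) (a i)
      = seqOf k a r := by
    have hmap : (Finset.Icc 1 k).val.map a = ∑ i ∈ Finset.Icc 1 k, {a i} := by
      have h := Multiset.sum_map_singleton ((Finset.Icc 1 k).val.map a)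
      rw [Multiset.map_map] at h
      exact h.symm
    rw [hmap, ← Finset.sum_add_distrib, seqOf]
    refine Finset.sum_congr rfl fun i hi => ?_
    rw [Multiset.singleton_add, ← Multiset.replicate_succ, Nat.sub_add_cancel (hr i hi)]
  have hsum : ∑ i ∈ Finset.Icc 1 k, i * r i
      = ∑ i ∈ Finset.Icc 1 k, i * (r i - 1) + ∑ i ∈ Finset.Icc 1 k, i := by
    rw [← Finset.sum_add_distrib]
    refine Finset.sum_congr rfl fun i hi => ?_
    rw [← Nat.mul_succ, Nat.succ_eq_add_one, Nat.sub_add_cancel (hr i hi)]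
  have hcons : (Finset.Icc 1 k).val.map a = (l : ℤ) ::ₘ (Finset.Ico 1 k).val.map a := by
    rw [hI, Finset.cons_val, Multiset.map_cons, hl]
  have h4 := card_subsums_le (seqOf k a r)
  have hsumk : ∑ i ∈ Finset.Icc 1 k, i = k + ∑ i ∈ Finset.Ico 1 k, i := by
    rw [hI, Finset.sum_cons]
  rw [← hIco] at h1
  rw [hseq, hcons] at h3
  omega

theorem image_cast_Ico (hpos : ∀ i ∈ Finset.Icc 1 k, 0 < a i)
    (hmono : StrictMonoOn a (Set.Icc 1 k)) (hk : 1 ≤ k) {l : ℕ} (hl : a k = l) :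
    ∃ B : Finset (ZMod l), B.val = ((Finset.Ico 1 k).val.map a).map (Int.cast : ℤ → ZMod l) ∧
      0 ∉ B ∧ B.card = k - 1 := by
  have hkI : k ∈ Finset.Icc 1 k := Finset.mem_Icc.2 ⟨hk, le_rfl⟩
  have hlt : ∀ i ∈ Finset.Ico 1 k, 0 < a i ∧ a i < l := by
    intro i hi
    rw [Finset.mem_Ico] at hi
    refine ⟨hpos i (Finset.mem_Icc.2 (by omega)), hl ▸ hmono ?_ ?_ hi.2⟩ <;>
      exact Set.mem_Icc.2 (by omega)
  have hinj : Set.InjOn (fun i => (a i : ZMod l)) (Finset.Ico 1 k : Finset ℕ) := by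
    intro i hi j hj hij
    have h1 := hlt i hi
    have h2 := hlt j hj
    have := cast_injOn_Ico l ⟨h1.1.le, h1.2⟩ ⟨h2.1.le, h2.2⟩ hij
    refine hmono.injOn ?_ ?_ this
    · have := Finset.mem_Ico.1 (Finset.mem_coe.1 hi)
      exact Set.mem_Icc.2 (by omega)
    · have := Finset.mem_Ico.1 (Finset.mem_coe.1 hj)
      exact Set.mem_Icc.2 (by omega)
  refine ⟨(Finset.Ico 1 k).image fun i => (a i : ZMod l), ?_, ?_, ?_⟩
  · rw [Finset.image_val_of_injOn hinj, Multiset.map_map]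
    rfl
  · intro h0
    obtain ⟨i, hi, h⟩ := Finset.mem_image.1 h0
    have h1 := hlt i hi
    have := cast_injOn_Ico l ⟨h1.1.le, h1.2⟩ ⟨le_rfl, by omega⟩ (h.trans Int.cast_zero.symm)
    omega
  · rw [Finset.card_image_of_injOn hinj, Nat.card_Ico]

/-- The preimage in `ℤ` is some `gℤ` containing every `a i` (`a k` maps to `0`), so `g` divides the
gcd. -/
theorem closure_eq_top_of_gcd_eq_one (hgcd : (Finset.Icc 1 k).gcd a = 1) {l : ℕ} (hl : a k = l)
    {B : Finset (ZMod l)}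
    (hB : B.val = ((Finset.Ico 1 k).val.map a).map (Int.cast : ℤ → ZMod l)) :
    AddSubgroup.closure (B : Set (ZMod l)) = ⊤ := by
  obtain ⟨g, hg⟩ := Int.subgroup_cyclic
    ((AddSubgroup.closure (B : Set (ZMod l))).comap (Int.castAddHom (ZMod l)))
  have hmem : ∀ z : ℤ, (z : ZMod l) ∈ AddSubgroup.closure (B : Set (ZMod l)) ↔ g ∣ z := by
    intro z
    rw [← Int.mem_zmultiples_iff, AddSubgroup.zmultiples_eq_closure, ← hg,
      AddSubgroup.mem_comap, Int.coe_castAddHom]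
  have hdvd : g ∣ (Finset.Icc 1 k).gcd a := by
    refine Finset.dvd_gcd fun i hi => (hmem _).1 ?_
    rcases eq_or_ne i k with rfl | hik
    · rw [hl, Int.cast_natCast, ZMod.natCast_self]
      exact zero_mem _
    · refine AddSubgroup.subset_closure ?_
      rw [Finset.mem_coe, ← Finset.mem_val, hB]
      refine Multiset.mem_map_of_mem _ (Multiset.mem_map_of_mem _ ?_)
      rw [Finset.mem_Icc] at hi
      rw [Finset.mem_val, Finset.mem_Ico]
      omega
  rw [hgcd] at hdvd
  rw [AddSubgroup.eq_top_iff']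
  intro x
  obtain ⟨z, rfl⟩ := ZMod.intCast_surjective x
  exact (hmem z).2 (hdvd.trans (one_dvd z))

end Increasing

/-! ### The two ranges of `a k`. -/

theorem theorem4p2 (k : ℕ) (hk : 1 ≤ k) (a : ℕ → ℤ) (r : ℕ → ℕ)
    (hpos : ∀ i ∈ Finset.Icc 1 k, 0 < a i)
    (hmono : StrictMonoOn a (Set.Icc 1 k))
    (hr : ∀ i ∈ Finset.Icc 1 k, 1 ≤ r i)
    (hgcd : (Finset.Icc 1 k).gcd a = 1) :
    (a k ≤ 2 * (k : ℤ) - 3 →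
      (∑ i ∈ Finset.Icc 1 k, (i : ℤ) * (r i : ℤ)) + a k - (k : ℤ)
        ≤ ((subsequenceSums (seqOf k a r)).card : ℤ)) ∧
    (2 * (k : ℤ) - 2 ≤ a k →
      (∑ i ∈ Finset.Icc 1 k, (i : ℝ) * (r i : ℝ)) + Real.goldenRatio * ((k : ℝ) + 1) - (k : ℝ) - 4
        ≤ ((subsequenceSums (seqOf k a r)).card : ℝ)) := by
  have hkI : k ∈ Finset.Icc 1 k := Finset.mem_Icc.2 ⟨hk, le_rfl⟩
  obtain ⟨l, hl⟩ := Int.eq_ofNat_of_zero_le (hpos k hkI).le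
  have hlpos : 0 < l := by
    have := hpos k hkI
    omega
  have : NeZero l := ⟨hlpos.ne'⟩
  obtain ⟨B, hB, hB0, hBcard⟩ := image_cast_Ico hpos hmono hk hl
  have hgain := fun m hm => sum_mul_add_le_card_subsequenceSums (m := m) hk hpos hmono hr hl
    (hB ▸ hm)
  constructor
  · intro hak
    have hall : subsums B.val = Finset.univ := by
      refine Finset.eq_univ_of_forall fun x => ?_
      obtain ⟨y, hy, z, hz, hyz, rfl⟩ := exists_ne_add_eq card_le_two_of_add_self_eq
        (C := insert 0 B) (Y := Finset.univ) (q := x) (Finset.subset_univ _)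
        (fun _ _ => Finset.mem_univ _) (by
          rw [Finset.card_insert_of_notMem hB0, Finset.card_univ, ZMod.card]
          omega)
      exact add_mem_subsums hy hz hyz
    have h := hgain l (by rw [hall, Finset.card_univ, ZMod.card])
    rw [hl]
    zify at h
    linarith
  · intro hak
    have hφ := Real.goldenRatio_lt_two
    rcases hk.eq_or_lt with rfl | hk2
    -- For `k = 1` the natural number `2 * k - 3` truncates to `0`; the empty sum supplies one
    -- residue instead.
    · have h := hgain 1 (Finset.card_pos.2 ⟨0, zero_mem_subsums _⟩)
      have h' : (∑ i ∈ Finset.Icc (1 : ℕ) 1, (i : ℝ) * (r i : ℝ)) + 1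
          ≤ ((subsequenceSums (seqOf 1 a r)).card : ℝ) + 1 := by
        exact_mod_cast h
      push_cast
      linarith
    · have hcard : 2 * k - 3 ≤ (subsums B.val).card := by
        rcases subsums_eq_closure_or_two_mul_card_le card_le_two_of_add_self_eq B hB0 with hc | hc
        · have hall : subsums B.val = Finset.univ := by
            refine Finset.eq_univ_of_forall fun x => (hc x).2 ?_
            rw [closure_eq_top_of_gcd_eq_one hgcd hl hB]
            exact AddSubgroup.mem_top x
          rw [hall, Finset.card_univ, ZMod.card]
          omega
        · omega
      have h := hgain _ hcard
      have h3 : ∑ i ∈ Finset.Icc 1 k, i * r i + k ≤ (subsequenceSums (seqOf k a r)).card + 3 := by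
        omega
      have h' : (∑ i ∈ Finset.Icc 1 k, (i : ℝ) * (r i : ℝ)) + (k : ℝ)
          ≤ ((subsequenceSums (seqOf k a r)).card : ℝ) + 3 := by
        exact_mod_cast h3
      have hk2' : (2 : ℝ) ≤ k := by exact_mod_cast hk2
      -- What is needed is `θ(k + 1) ≤ 2k + 1`; at `k = 2`, the tightest case, this reads `θ ≤ 5/3`.
      have hφ' : Real.goldenRatio ≤ 5 / 3 := by
        nlinarith [Real.goldenRatio_sq, Real.goldenRatio_pos]
      nlinarith
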